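/- Let $G$ be a graph on the vertices $1,\dots,n$, and let $\mathbf p=(\mathbf p_1,\dots,\mathbf p_n)$ be a configuration of points in $\mathbb R^d$ such that $\mathbf p_i\neq\mathbf p_j$ for every edge $ij$ of $G$. Let $\ell$ be the dimension of the affine span of $\mathbf p$. A configuration $\mathbf q$ is called $\ell$-pinned if $\mathbf q_1=0$ and, for $2\le i\le \ell+1$, $\mathbf q_i$ lies in the span of the first $i-1$ coordinate vectors. Assume that $\mathbf p$ is pinned, that is, $\mathbf p$ is $\ell$-pinned and $\mathbf p_1,\dots,\mathbf p_{\ell+1}$ are affinely independent. The framework $(G,\mathbf p)$ is rigid if every configuration $\mathbf q$ close enough to $\mathbf p$ with $|\mathbf q_i-\mathbf q_j|=|\mathbf p_i-\mathbf p_j|$ for all edges $ij$ satisfies these equations for all pairs $ij$; otherwise it is flexible. A trajectory at $\mathbf p$ is a non-constant analytic map $\mathbf p(t)$, $t\in[0,\varepsilon]$ with $\varepsilon>0$, into the $\ell$-pinned configurations, with $\mathbf p(0)=\mathbf p$. For integers $j,k\ge 1$, a $(j,k)$-flex is a trajectory $\mathbf p(t)$ at $\mathbf p$ such that $\mathbf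 p^{(i)}(0)=0$ for $1\le i<j$, $\mathbf p^{(j)}(0)\ne0$, and, for each edge $ij$, the derivatives of orders $1,\dots,k$ of $|\mathbf p_i(t)-\mathbf p_j(t)|^2$ vanish at $t=0$. Let $K$ be the linear space formed by $0$ and the velocities $\mathbf p'(0)$ of the $(1,1)$-flexes. A stiff-bar energy is a function $E(\mathbf q)=\sum_{ij\in G}E_{ij}(|\mathbf q_i-\mathbf q_j|)$ of $\ell$-pinned configurations $\mathbf q$ where each $E_{ij}:\mathbb R\to\mathbb R$ is analytic at $d_{ij}=|\mathbf p_i-\mathbf p_j|$, has a strict local minimum there, and satisfies $E_{ij}''(d_{ij})>0$. It has tight growth order $s>0$ at $\mathbf p$ if (a) there is $c_1>0$ such that $E(\mathbf q)-E(\mathbf p)\ge c_1|\mathbf q-\mathbf p|^s$ for all $\ell$-pinned $\mathbf q$ near $\mathbf p$, and (b) there are a trajectory $\mathbf p(t)$ at $\mathbf p$ and $c_2,\delta>0$ such that $E(\mathbf p(t))-E(\mathbf p)\le c_2|\mathbf p(t)-\mathbf p|^s$ for $t\in[0,\delta]$. A rigid framework has rigidity order $\nu\in\mathbb Q$ if every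 stiff-bar energy has tight growth order $2\nu$ at $\mathbf p$. Suppose that $\dim K=1$. Then: 1. If, for some integer $k\ge2$, $(G,\mathbf p)$ has a $(1,k-1)$-flex but no $(1,k)$-flex, then $(G,\mathbf p)$ is rigid and its rigidity order is $k$. 2. If, for some integer $k\ge1$, $(G,\mathbf p)$ has a $(1,k)$-flex, then it is flexible, or it is rigid with a rigidity order $\nu\ge k+1$. 3. (Alexandrov's theorem.) If, for some integer $k\ge1$, $(G,\mathbf p)$ has no $(1,k)$-flex, then it is rigid. -/

import Mathlib

open Set Filter Topology

namespace BarFramework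

/-- Configurations of `n` points in `ℝ^d`, with the Euclidean norm of `ℝ^(nd)`; the entry at
`(i, c)` is the `c`-th coordinate of the `i`-th point. -/
abbrev Config (n d : ℕ) : Type :=
  EuclideanSpace ℝ (Fin n × Fin d)

variable {n d : ℕ}

/-- The `i`-th point of the configuration `q`. -/
def point (q : Config n d) (i : Fin n) : EuclideanSpace ℝ (Fin d) :=
  WithLp.toLp 2 (fun c => q (i, c))

/-- The length of an edge in the configuration `q`. -/
noncomputable def edgeLength (q : Config n d) : Sym2 (Fin n) → ℝ :=
  Sym2.lift ⟨fun i j => ‖point q i - point q j‖, fun i j => norm_sub_rev (point q i) (point q j)⟩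

/-- `(G, p)` and `(G, q)` have the same edge lengths. -/
def IsEquivalent (G : SimpleGraph (Fin n)) (p q : Config n d) : Prop :=
  ∀ e ∈ G.edgeSet, edgeLength p e = edgeLength q e

/-- All pairwise distances agree. -/
def IsCongruent (p q : Config n d) : Prop :=
  ∀ i j : Fin n, ‖point p i - point p j‖ = ‖point q i - point q j‖

/-- Local rigidity in `ℝ^d`, among all configurations (not only the pinned ones). -/
def IsRigid (G : SimpleGraph (Fin n)) (p : Config n d) : Prop :=
  ∃ U ∈ 𝓝 p, ∀ q ∈ U, IsEquivalent G p q → IsCongruent p q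

/-- A framework that is not locally rigid. -/
def IsFlexible (G : SimpleGraph (Fin n)) (p : Config n d) : Prop :=
  ¬ IsRigid G p

/-- The dimension `ℓ` of the affine span of the points of `p`. -/
noncomputable def spanDim (p : Config n d) : ℕ :=
  Module.finrank ℝ (vectorSpan ℝ (Set.range fun i : Fin n => point p i))

/-- `ℓ`-pinned position. Vertices are numbered from `0`, so that for `i ≤ ℓ` the point `point q i` has
to lie in the span of the first `i` coordinate vectors; in particular `point q 0` is the origin. -/
def IsPinnedAt (l : ℕ) (q : Config n d) : Prop :=
  ∀ i : Fin n, (i : ℕ) ≤ l → ∀ c : Fin d, (i : ℕ) ≤ (c : ℕ) → point q i c = 0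

/-- The first `ℓ + 1` points are affinely independent, `ℓ` being the dimension of the affine span. -/
def IsNondegenerate (p : Config n d) : Prop :=
  AffineIndependent ℝ (fun i : {i : Fin n // (i : ℕ) ≤ spanDim p} => point p i.1)

/-- Pinned position. -/
def IsPinned (p : Config n d) : Prop :=
  IsNondegenerate p ∧ IsPinnedAt (spanDim p) p

/-- A trajectory at `p`: analytic on some `[0, ε]` (that is, on a neighbourhood of this interval),
starting at `p`, non-constant and `ℓ`-pinned there. -/
def IsTrajectory (p : Config n d) (γ : ℝ → Config n d) : Prop :=
  ∃ ε : ℝ, 0 < ε ∧ AnalyticOnNhd ℝ γ (Icc 0 ε) ∧ γ 0 = p ∧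
    (∀ t ∈ Icc 0 ε, IsPinnedAt (spanDim p) (γ t)) ∧ ∃ t ∈ Icc 0 ε, γ t ≠ p

/-- The first `k` derivatives vanish at `0`. -/
def IsVanishing {F : Type*} [NormedAddCommGroup F] [NormedSpace ℝ F] (k : ℕ) (f : ℝ → F) : Prop :=
  ∀ i : ℕ, 1 ≤ i → i ≤ k → iteratedDeriv i f 0 = 0

/-- `j`-active, for `j ≥ 1`: `(j-1)`-vanishing but not `j`-vanishing. -/
def IsActive {F : Type*} [NormedAddCommGroup F] [NormedSpace ℝ F] (j : ℕ) (f : ℝ → F) : Prop :=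
  IsVanishing (j - 1) f ∧ ¬ IsVanishing j f

/-- `γ` is a `(j,k)`-flex of `(G, p)`, where `j, k ≥ 1`: a `j`-active trajectory along which all
squared edge lengths are `k`-vanishing. -/
def IsFlex (G : SimpleGraph (Fin n)) (p : Config n d) (j k : ℕ) (γ : ℝ → Config n d) : Prop :=
  1 ≤ j ∧ 1 ≤ k ∧ IsTrajectory p γ ∧ IsActive j γ ∧
    ∀ e ∈ G.edgeSet, IsVanishing k (fun t => edgeLength (γ t) e ^ 2)

/-- `(G, p)` has a `(j,k)`-flex. -/
def HasFlex (G : SimpleGraph (Fin n)) (p : Config n d) (j k : ℕ) : Prop :=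
  ∃ γ : ℝ → Config n d, IsFlex G p j k γ

/-- The linear space `K` of the coefficients `p'` of the `(1,1)`-flexes, together with `0`. -/
def firstOrderFlexes (G : SimpleGraph (Fin n)) (p : Config n d) : Submodule ℝ (Config n d) :=
  Submodule.span ℝ {v | ∃ γ : ℝ → Config n d, IsFlex G p 1 1 γ ∧ deriv γ 0 = v}

/-- The edge-based energy with the edge potentials `E e`, `e` an edge of `G`. -/
noncomputable def energy (G : SimpleGraph (Fin n)) [DecidableRel G.Adj]
    (E : Sym2 (Fin n) → ℝ → ℝ) (q : Config n d) : ℝ :=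
  ∑ e ∈ G.edgeFinset, E e (edgeLength q e)

/-- The potentials `E` define a bar-like energy at `p`. -/
def IsBarLike (G : SimpleGraph (Fin n)) (p : Config n d) (E : Sym2 (Fin n) → ℝ → ℝ) : Prop :=
  ∀ e ∈ G.edgeSet, edgeLength p e ≠ 0 ∧ AnalyticAt ℝ (E e) (edgeLength p e) ∧
    ∀ᶠ x in 𝓝[≠] (edgeLength p e), E e (edgeLength p e) < E e x

/-- The potentials `E` define a stiff-bar energy at `p`. -/
def IsStiffBar (G : SimpleGraph (Fin n)) (p : Config n d) (E : Sym2 (Fin n) → ℝ → ℝ) : Prop :=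
  IsBarLike G p E ∧ ∀ e ∈ G.edgeSet, 0 < iteratedDeriv 2 (E e) (edgeLength p e)

/-- `Φ` grows always-`s`-quickly at `p`, as a function on `ℓ`-pinned configurations. -/
def GrowsQuickly (Φ : Config n d → ℝ) (p : Config n d) (s : ℝ) : Prop :=
  ∃ c : ℝ, 0 < c ∧ ∃ U ∈ 𝓝 p, ∀ q ∈ U, IsPinnedAt (spanDim p) q →
    c * ‖q - p‖ ^ s ≤ Φ q - Φ p

/-- `Φ` grows sometimes-`s`-slowly at `p`, as a function on `ℓ`-pinned configurations. -/
def GrowsSlowly (Φ : Config n d → ℝ) (p : Config n d) (s : ℝ) : Prop :=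
  ∃ γ : ℝ → Config n d, IsTrajectory p γ ∧ ∃ c δ : ℝ, 0 < c ∧ 0 < δ ∧
    ∀ t ∈ Icc 0 δ, Φ (γ t) - Φ p ≤ c * ‖γ t - p‖ ^ s

/-- `s > 0` is the tight growth order of `Φ` at `p`. -/
def HasTightGrowthOrder (Φ : Config n d → ℝ) (p : Config n d) (s : ℝ) : Prop :=
  0 < s ∧ GrowsSlowly Φ p s ∧ GrowsQuickly Φ p s

/-- The framework `(G, p)` is rigid, with rigidity order `ν`: every stiff-bar energy at `p` has
tight growth order `2ν` at `p`. -/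
def HasRigidityOrder (G : SimpleGraph (Fin n)) [DecidableRel G.Adj] (p : Config n d) (ν : ℚ) :
    Prop :=
  IsRigid G p ∧ ∀ E : Sym2 (Fin n) → ℝ → ℝ, IsStiffBar G p E →
    HasTightGrowthOrder (energy G E) p (2 * (ν : ℝ))

end BarFramework

/-!
Restrict the map `F` of squared edge lengths to pinned configurations. The assumption says that the
kernel of `dF` at `p` is a line, so Lyapunov–Schmidt reduction yields an analytic curve `γ` through
`p`, with velocity in that kernel, such that every pinned `q` near `p` lies within
`O(‖F q - F p‖)` of `γ`. If `F` is constant along `γ`, the curve is a motion of the framework.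
Otherwise `F (γ t) - F p` has an exact finite order `m` in `t`, and then
`‖q - p‖ ^ m = O(‖F q - F p‖)` for pinned `q`: this bounds the order of every flex by `m - 1`, while
`γ` attains it. Since a stiff-bar energy is comparable to `‖F q - F p‖ ^ 2`, its tight growth order
is `2 * m`. Rigidity among all configurations reduces to the pinned ones because Gram–Schmidt
orthonormalization moves a configuration near `p` continuously to a congruent pinned one.
-/

namespace BarFramework

open Asymptotics InnerProductSpace

section AnalyticGerms

variable {𝕜 F : Type*} [NontriviallyNormedField 𝕜] [NormedAddCommGroup F] [NormedSpace 𝕜 F]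

theorem le_of_sub_pow_isBigO_sub_pow {z : 𝕜} {l : Filter 𝕜} [l.NeBot] (hl : l ≤ 𝓝[≠] z) {m k : ℕ}
    (h : (fun x => (x - z) ^ m) =O[l] fun x => (x - z) ^ k) : k ≤ m := by
  by_contra! hmk
  have hne : ∀ᶠ x in l, (x - z) ^ m ≠ 0 :=
    hl (eventually_mem_nhdsWithin.mono fun _ hx => pow_ne_zero m (sub_ne_zero.mpr hx))
  exact h.not_isLittleO hne.frequently
    (((isLittleO_pow_pow hmk).comp_tendsto (tendsto_sub_nhds_zero_iff.mpr tendsto_id)).mono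
      (hl.trans nhdsWithin_le_nhds))

theorem isTheta_pow_of_analyticOrderAt_eq {f : 𝕜 → F} {z : 𝕜} {k : ℕ} (hf : AnalyticAt 𝕜 f z)
    (hk : analyticOrderAt f z = k) : f =Θ[𝓝 z] fun x => (x - z) ^ k := by
  obtain ⟨g, hg, hgz, hfg⟩ := hf.analyticOrderAt_eq_natCast.mp hk
  have hg1 : g =Θ[𝓝 z] fun _ => (1 : 𝕜) :=
    ⟨hg.continuousAt.isBigO_one 𝕜, (isBigO_const_left_iff_pos_le_norm one_ne_zero).mpr
      ⟨‖g z‖ / 2, by positivity, hg.continuousAt.norm.eventually_const_le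
        (half_lt_self (norm_pos_iff.mpr hgz))⟩⟩
  refine EventuallyEq.trans_isTheta hfg ?_
  simpa only [smul_eq_mul, mul_one] using (isTheta_refl (fun x => (x - z) ^ k) (𝓝 z)).smul hg1

theorem isBigO_pow_iff_le_analyticOrderAt {f : 𝕜 → F} {z : 𝕜} (hf : AnalyticAt 𝕜 f z) {k : ℕ} :
    (f =O[𝓝 z] fun x => (x - z) ^ k) ↔ (k : ℕ∞) ≤ analyticOrderAt f z := by
  refine ⟨fun h => ?_, fun h => ?_⟩
  · by_contra! hlt
    obtain ⟨m, hm⟩ := ENat.ne_top_iff_exists.mp hlt.ne_top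
    have hkm : k ≤ m := le_of_sub_pow_isBigO_sub_pow le_rfl
      (((isTheta_pow_of_analyticOrderAt_eq hf hm.symm).2.trans h).mono nhdsWithin_le_nhds)
    rw [← hm, Nat.cast_lt] at hlt
    exact hlt.not_ge hkm
  · obtain ⟨g, hg, hfg⟩ := (natCast_le_analyticOrderAt hf).mp h
    refine EventuallyEq.trans_isBigO hfg ?_
    simpa only [smul_eq_mul, mul_one] using
      (isBigO_refl (fun x => (x - z) ^ k) (𝓝 z)).smul (hg.continuousAt.isBigO_one 𝕜)

theorem eventually_eq_or_exists_isTheta_pow {f : 𝕜 → F} {z : 𝕜} (hf : AnalyticAt 𝕜 f z) :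
    (∀ᶠ x in 𝓝 z, f x = f z) ∨ ∃ m : ℕ, (fun x => f x - f z) =Θ[𝓝 z] fun x => (x - z) ^ m := by
  have hf' : AnalyticAt 𝕜 (fun x => f x - f z) z := hf.sub analyticAt_const
  by_cases htop : analyticOrderAt (fun x => f x - f z) z = ⊤
  · exact .inl ((analyticOrderAt_eq_top.mp htop).mono fun _ => sub_eq_zero.mp)
  · obtain ⟨m, hm⟩ := ENat.ne_top_iff_exists.mp htop
    exact .inr ⟨m, isTheta_pow_of_analyticOrderAt_eq hf' hm.symm⟩

theorem iteratedDeriv_sub_const {i : ℕ} (hi : i ≠ 0) (f : 𝕜 → F) (c : F) :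
    iteratedDeriv i (fun t => f t - c) = iteratedDeriv i f := by
  obtain ⟨j, rfl⟩ := Nat.exists_eq_succ_of_ne_zero hi
  simp only [Nat.succ_eq_add_one, iteratedDeriv_succ', deriv_sub_const_fun]

theorem isTheta_sub_of_hasDerivAt {f : 𝕜 → F} {v : F} {z : 𝕜} (hf : HasDerivAt f v z)
    (hv : v ≠ 0) : (fun t => f t - f z) =Θ[𝓝 z] fun t => t - z := by
  simpa only [IsTheta, Filter.prod_pure, isBigO_map, Function.comp_def] using
    HasDerivAtFilter.isTheta_sub hf hv

end AnalyticGerms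

section Vanishing

variable {F : Type*} [NormedAddCommGroup F] [NormedSpace ℝ F]

theorem isVanishing_iff_isBigO [CompleteSpace F] {f : ℝ → F} (hf : AnalyticAt ℝ f 0) {k : ℕ} :
    IsVanishing k f ↔ (fun t => f t - f 0) =O[𝓝 0] fun t => t ^ (k + 1) := by
  have hf' : AnalyticAt ℝ (fun t => f t - f 0) 0 := hf.sub analyticAt_const
  have hO := isBigO_pow_iff_le_analyticOrderAt hf' (k := k + 1)
  simp only [sub_zero] at hO
  rw [hO, natCast_le_analyticOrderAt_iff_iteratedDeriv_eq_zero hf']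
  refine ⟨fun h i hi => ?_, fun h i hi hik => ?_⟩
  · obtain rfl | hi₀ := eq_or_ne i 0
    · simp only [iteratedDeriv_zero, sub_self]
    · exact iteratedDeriv_sub_const hi₀ f (f 0) ▸ h i (by lia) (by lia)
  · exact iteratedDeriv_sub_const (Nat.one_le_iff_ne_zero.mp hi) f (f 0) ▸ h i (by lia)

theorem isVanishing_one_iff {f : ℝ → F} : IsVanishing 1 f ↔ deriv f 0 = 0 := by
  refine ⟨fun h => iteratedDeriv_one (f := f) ▸ h 1 le_rfl le_rfl, fun h i hi hi1 => ?_⟩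
  rw [le_antisymm hi1 hi, iteratedDeriv_one, h]

theorem isActive_one_iff {f : ℝ → F} : IsActive 1 f ↔ deriv f 0 ≠ 0 := by
  rw [IsActive, isVanishing_one_iff]
  exact and_iff_right fun i hi hi0 => absurd hi (by lia)

theorem IsVanishing.of_le {k k' : ℕ} {f : ℝ → F} (h : IsVanishing k f) (hle : k' ≤ k) :
    IsVanishing k' f :=
  fun i hi hik => h i hi (hik.trans hle)

end Vanishing

section LyapunovSchmidt

variable {V W : Type*} [NormedAddCommGroup V] [NormedSpace ℝ V] [NormedAddCommGroup W]
  [NormedSpace ℝ W]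

theorem exists_leftInverse_modulo_ker [FiniteDimensional ℝ W] (A : V →L[ℝ] W)
    (hA : Module.finrank ℝ (LinearMap.ker A.toLinearMap) = 1) :
    ∃ (v : V) (φ : V →L[ℝ] ℝ) (B : W →L[ℝ] V), A v = 0 ∧ φ v = 1 ∧
      ∀ x, B (A x) = x - φ x • v := by
  obtain ⟨⟨v, hAv⟩, hv, hspan⟩ := finrank_eq_one_iff'.mp hA
  obtain ⟨φ, hφ⟩ := SeparatingDual.exists_eq_one (R := ℝ) (x := v) (by simpa using hv)
  let N := LinearMap.ker φ.toLinearMap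
  have hinj : LinearMap.ker (A.toLinearMap ∘ₗ N.subtype) = ⊥ := by
    refine LinearMap.ker_eq_bot'.mpr fun ⟨x, hx⟩ hAx => ?_
    obtain ⟨a, ha⟩ := hspan ⟨x, hAx⟩
    obtain rfl : a • v = x := congrArg Subtype.val ha
    have ha0 : a = 0 := by simpa [N, hφ] using hx
    simp [ha0]
  obtain ⟨g, hg⟩ := LinearMap.exists_leftInverse_of_injective _ hinj
  refine ⟨v, φ, LinearMap.toContinuousLinearMap (N.subtype ∘ₗ g), hAv, hφ, fun x => ?_⟩
  have hx : x - φ x • v ∈ N := by simp [N, hφ]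
  have hgx : g (A (x - φ x • v)) = ⟨x - φ x • v, hx⟩ := LinearMap.congr_fun hg ⟨_, hx⟩
  rw [map_sub, map_smul, show A v = 0 from hAv, smul_zero, sub_zero] at hgx
  simp [hgx]

theorem norm_sub_pow_isBigO_of_curve {F : V → W} {F' : V →L[ℝ] W} {x₀ : V}
    (hF : HasStrictFDerivAt F F' x₀) {γ : ℝ → V} (hγ : DifferentiableAt ℝ γ 0) (hγ₀ : γ 0 = x₀)
    {φ : V →L[ℝ] ℝ}
    (hclose : (fun x => x - γ (φ (x - x₀))) =O[𝓝 x₀] fun x => F x - F x₀) {m : ℕ} (hm : m ≠ 0)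
    (horder : (fun t => t ^ m) =O[𝓝 0] fun t => F (γ t) - F x₀) :
    (fun x => ‖x - x₀‖ ^ m) =O[𝓝 x₀] fun x => F x - F x₀ := by
  have hφ : Tendsto (fun x => φ (x - x₀)) (𝓝 x₀) (𝓝 0) := by
    simpa using (by fun_prop : Continuous fun x => φ (x - x₀)).tendsto x₀
  have hpair : Tendsto (fun x => (γ (φ (x - x₀)), x)) (𝓝 x₀) (𝓝 (x₀, x₀)) :=
    ((hγ₀ ▸ hγ.continuousAt.tendsto).comp hφ).prodMk_nhds tendsto_id
  have hcurve : (fun x => F (γ (φ (x - x₀))) - F x₀) =O[𝓝 x₀] fun x => F x - F x₀ := by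
    have := ((hF.isBigO_sub.comp_tendsto hpair).trans
      (hclose.neg_left.congr_left fun x => neg_sub _ _)).add (isBigO_refl _ _)
    simpa using this
  have hφ_pow : (fun x => ‖φ (x - x₀)‖ ^ m) =O[𝓝 x₀] fun x => F x - F x₀ := by
    simpa only [Function.comp_def, norm_pow] using ((horder.comp_tendsto hφ).trans hcurve).norm_left
  have hF_pow : (fun x => ‖F x - F x₀‖ ^ m) =O[𝓝 x₀] fun x => F x - F x₀ := by
    have hF₀ : Tendsto (fun x => ‖F x - F x₀‖) (𝓝 x₀) (𝓝 0) := by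
      simpa using (hF.continuousAt.sub_const (F x₀)).norm
    refine IsBigO.of_bound' ((hF₀.eventually_le_const one_pos).mono fun x hx => ?_)
    simpa using pow_le_of_le_one (norm_nonneg _) hx hm
  have hdist : (fun x => x - x₀) =O[𝓝 x₀] fun x => ‖F x - F x₀‖ + ‖φ (x - x₀)‖ := by
    have hγO : (fun x => γ (φ (x - x₀)) - x₀) =O[𝓝 x₀] fun x => φ (x - x₀) := by
      simpa [hγ₀, Function.comp_def] using hγ.isBigO_sub.comp_tendsto hφ
    simpa using hclose.norm_right.add_add hγO.norm_right
  have hadd : (fun x => (‖F x - F x₀‖ + ‖φ (x - x₀)‖) ^ m) =O[𝓝 x₀]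
      fun x => ‖F x - F x₀‖ ^ m + ‖φ (x - x₀)‖ ^ m := by
    refine .of_bound (2 ^ (m - 1)) (.of_forall fun x => ?_)
    refine (Real.norm_of_nonneg (by positivity)).trans_le ?_
    exact (add_pow_le (norm_nonneg _) (norm_nonneg _) m).trans
      (mul_le_mul_of_nonneg_left (le_abs_self _) (by positivity))
  exact (hdist.norm_left.pow m).trans (hadd.trans (hF_pow.add hφ_pow))

variable [CompleteSpace V]

theorem exists_analyticAt_localInverse {Ψ : V → V} {x₀ : V} (hΨ_an : AnalyticAt ℝ Ψ x₀)
    (hΨ : HasStrictFDerivAt Ψ (ContinuousLinearMap.id ℝ V) x₀) :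
    ∃ g : V → V, AnalyticAt ℝ g (Ψ x₀) ∧
      HasStrictFDerivAt g (ContinuousLinearMap.id ℝ V) (Ψ x₀) ∧ ∀ᶠ x in 𝓝 x₀, g (Ψ x) = x := by
  replace hΨ : HasStrictFDerivAt Ψ (ContinuousLinearEquiv.refl ℝ V : V →L[ℝ] V) x₀ := hΨ
  refine ⟨hΨ.localInverse Ψ _ x₀, ?_, hΨ.to_localInverse, hΨ.eventually_left_inverse⟩
  have := (hΨ.toOpenPartialHomeomorph Ψ).analyticAt_symm' (i := ContinuousLinearEquiv.refl ℝ V)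
    hΨ.mem_toOpenPartialHomeomorph_source hΨ_an hΨ.hasFDerivAt.fderiv
  rwa [hΨ.toOpenPartialHomeomorph_coe] at this

theorem exists_curve_sub_isBigO {F : V → W} {x₀ : V} (hF : AnalyticAt ℝ F x₀) {v : V}
    {φ : V →L[ℝ] ℝ} {B : W →L[ℝ] V} (hB : ∀ x, B (fderiv ℝ F x₀ x) = x - φ x • v) :
    ∃ γ : ℝ → V, AnalyticAt ℝ γ 0 ∧ γ 0 = x₀ ∧ HasDerivAt γ v 0 ∧
      (fun x => x - γ (φ (x - x₀))) =O[𝓝 x₀] fun x => F x - F x₀ := by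
  -- The derivative of `Ψ` at `x₀` is the identity, and `γ` will be the `Ψ`-preimage of `ℝ v`.
  let Ψ : V → V := fun x => φ (x - x₀) • v + B (F x - F x₀)
  have hΨ₀ : Ψ x₀ = 0 := by simp [Ψ]
  have hΨ_an : AnalyticAt ℝ Ψ x₀ :=
    (((φ.analyticAt _).fun_comp (analyticAt_id.sub analyticAt_const)).smul analyticAt_const).add
      ((B.analyticAt _).fun_comp (hF.sub analyticAt_const))
  have hΨ : HasStrictFDerivAt Ψ (ContinuousLinearMap.id ℝ V) x₀ := by
    refine (((φ.hasStrictFDerivAt.comp x₀ ((hasStrictFDerivAt_id x₀).sub_const x₀)).smul_const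
      v).add (B.hasStrictFDerivAt.comp x₀ (hF.hasStrictFDerivAt.sub_const _))).congr_fderiv ?_
    ext x
    simp [hB]
  obtain ⟨g, hg_an, hg, hleft⟩ := exists_analyticAt_localInverse hΨ_an hΨ
  have hg₀ : g 0 = x₀ := hΨ₀ ▸ hleft.self_of_nhds
  rw [hΨ₀] at hg_an hg
  have hline : HasDerivAt (fun t : ℝ => t • v) v 0 := by
    simpa using (hasDerivAt_id (0 : ℝ)).smul_const v
  have hgd : HasFDerivAt g (ContinuousLinearMap.id ℝ V) ((0 : ℝ) • v) := by
    simpa only [zero_smul] using hg.hasFDerivAt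
  refine ⟨fun t => g (t • v), ?_, by simpa using hg₀, ?_, ?_⟩
  · exact AnalyticAt.fun_comp (by simpa using hg_an) (analyticAt_id.smul analyticAt_const)
  · exact HasFDerivAt.comp_hasDerivAt (0 : ℝ) hgd hline
  have hpair : Tendsto (fun x => (Ψ x, φ (x - x₀) • v)) (𝓝 x₀) (𝓝 (0, 0)) := by
    have hφv : ContinuousAt (fun x => φ (x - x₀) • v) x₀ := by fun_prop
    simpa [hΨ₀] using hΨ_an.continuousAt.tendsto.prodMk_nhds hφv.tendsto
  have hgΨ : (fun x => x - g (φ (x - x₀) • v)) =O[𝓝 x₀] fun x => B (F x - F x₀) := by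
    refine (hg.isBigO_sub.comp_tendsto hpair).congr' ?_ (.of_forall fun x => by simp [Ψ])
    filter_upwards [hleft] with x hx using by simp [hx]
  exact hgΨ.trans (B.isBigO_comp _ _)

theorem exists_curve_eventually_eq_or_isBigO [FiniteDimensional ℝ W] {F : V → W} {x₀ : V}
    (hF : AnalyticAt ℝ F x₀)
    (hker : Module.finrank ℝ (LinearMap.ker (fderiv ℝ F x₀).toLinearMap) = 1) :
    ∃ (γ : ℝ → V) (v : V), AnalyticAt ℝ γ 0 ∧ γ 0 = x₀ ∧ HasDerivAt γ v 0 ∧ v ≠ 0 ∧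
      ((∀ᶠ t in 𝓝 0, F (γ t) = F x₀) ∨ ∃ m : ℕ, 2 ≤ m ∧
        (fun t => F (γ t) - F x₀) =O[𝓝 0] (fun t => t ^ m) ∧
        (fun x => ‖x - x₀‖ ^ m) =O[𝓝 x₀] fun x => F x - F x₀) := by
  obtain ⟨v, φ, B, hv, hφ, hB⟩ := exists_leftInverse_modulo_ker _ hker
  obtain ⟨γ, hγ, hγ₀, hγv, hclose⟩ := exists_curve_sub_isBigO hF hB
  have hv₀ : v ≠ 0 := by rintro rfl; simp at hφ
  refine ⟨γ, v, hγ, hγ₀, hγv, hv₀, ?_⟩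
  have hFγ : AnalyticAt ℝ (fun t => F (γ t)) 0 := AnalyticAt.fun_comp (hγ₀.symm ▸ hF) hγ
  refine (eventually_eq_or_exists_isTheta_pow hFγ).imp (fun h => by simpa only [hγ₀] using h) ?_
  rintro ⟨m, hm⟩
  have hderiv : deriv (fun t => F (γ t)) 0 = 0 := by
    have hF' : HasFDerivAt F (fderiv ℝ F x₀) (γ 0) := hγ₀ ▸ hF.differentiableAt.hasFDerivAt
    exact (hF'.comp_hasDerivAt (0 : ℝ) hγv).deriv.trans hv
  have hm2 : 2 ≤ m := by
    have := FiniteDimensional.complete ℝ W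
    have h2 := (isVanishing_iff_isBigO hFγ).mp (isVanishing_one_iff.mpr hderiv)
    refine le_of_sub_pow_isBigO_sub_pow (z := (0 : ℝ)) le_rfl ?_
    simp only [sub_zero] at hm ⊢
    exact (hm.2.trans h2).mono nhdsWithin_le_nhds
  simp only [hγ₀, sub_zero] at hm
  exact ⟨m, hm2, hm.1, norm_sub_pow_isBigO_of_curve hF.hasStrictFDerivAt hγ.differentiableAt hγ₀
    hclose (by lia) hm.2⟩

end LyapunovSchmidt

section RigidityMap

variable {n d : ℕ}

/-- The squared edge lengths of a configuration. Squaring makes this map analytic everywhere, with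
the same level sets as the edge lengths themselves. -/
noncomputable def rigidityMap (G : SimpleGraph (Fin n)) (q : Config n d) : G.edgeSet → ℝ :=
  fun e => edgeLength q e ^ 2

theorem edgeLength_nonneg (q : Config n d) (e : Sym2 (Fin n)) : 0 ≤ edgeLength q e :=
  e.ind fun i j => norm_nonneg (point q i - point q j)

theorem continuous_point (i : Fin n) : Continuous fun q : Config n d => point q i := by
  unfold point
  fun_prop

theorem continuous_edgeLength (e : Sym2 (Fin n)) :
    Continuous fun q : Config n d => edgeLength q e :=
  e.ind fun i j => ((continuous_point i).sub (continuous_point j)).norm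

theorem analyticAt_edgeLength_sq (e : Sym2 (Fin n)) (q : Config n d) :
    AnalyticAt ℝ (fun q : Config n d => edgeLength q e ^ 2) q := by
  induction e with
  | h i j =>
    have hsum : (fun q : Config n d => edgeLength q s(i, j) ^ 2) =
        fun q => ∑ c, (q (i, c) - q (j, c)) ^ 2 :=
      funext fun q => EuclideanSpace.real_norm_sq_eq (point q i - point q j)
    have hcoord (x : Fin n × Fin d) : AnalyticAt ℝ (fun q : Config n d => q x) q :=
      (EuclideanSpace.proj x : Config n d →L[ℝ] ℝ).analyticAt q
    rw [hsum]
    exact Finset.analyticAt_fun_sum _ fun c _ => ((hcoord (i, c)).fun_sub (hcoord (j, c))).fun_pow 2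

variable {G : SimpleGraph (Fin n)}

theorem isEquivalent_iff_rigidityMap_eq {p q : Config n d} :
    IsEquivalent G p q ↔ rigidityMap G p = rigidityMap G q := by
  simp only [IsEquivalent, funext_iff, rigidityMap, Subtype.forall,
    sq_eq_sq₀ (edgeLength_nonneg _ _) (edgeLength_nonneg _ _)]

theorem analyticAt_rigidityMap [Fintype G.edgeSet] (q : Config n d) :
    AnalyticAt ℝ (rigidityMap G) q :=
  AnalyticAt.pi fun e => analyticAt_edgeLength_sq e.1 q

theorem forall_isVanishing_iff_isBigO [Fintype G.edgeSet] {γ : ℝ → Config n d}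
    (hγ : AnalyticAt ℝ γ 0) {k : ℕ} :
    (∀ e ∈ G.edgeSet, IsVanishing k fun t => edgeLength (γ t) e ^ 2) ↔
      (fun t => rigidityMap G (γ t) - rigidityMap G (γ 0)) =O[𝓝 0] fun t => t ^ (k + 1) := by
  have hlen (e : Sym2 (Fin n)) : AnalyticAt ℝ (fun t => edgeLength (γ t) e ^ 2) 0 :=
    (analyticAt_edgeLength_sq e _).fun_comp hγ
  simp only [isBigO_pi, Subtype.forall, isVanishing_iff_isBigO (hlen _)]
  rfl

theorem forall_isVanishing_one_iff_fderiv_eq_zero {γ : ℝ → Config n d}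
    (hγ : DifferentiableAt ℝ γ 0) :
    (∀ e ∈ G.edgeSet, IsVanishing 1 fun t => edgeLength (γ t) e ^ 2) ↔
      fderiv ℝ (rigidityMap G) (γ 0) (deriv γ 0) = 0 := by
  have := Fintype.ofFinite G.edgeSet
  have hF : HasDerivAt (fun t => rigidityMap G (γ t))
      (fderiv ℝ (rigidityMap G) (γ 0) (deriv γ 0)) 0 :=
    (analyticAt_rigidityMap (γ 0)).differentiableAt.hasFDerivAt.comp_hasDerivAt 0 hγ.hasDerivAt
  have hlen (e : G.edgeSet) : deriv (fun t => edgeLength (γ t) e ^ 2) 0 =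
      fderiv ℝ (rigidityMap G) (γ 0) (deriv γ 0) e := (hasDerivAt_pi.mp hF e).deriv
  simp only [isVanishing_one_iff, funext_iff, ← hlen, Subtype.forall, Pi.zero_apply]

end RigidityMap

section Trajectories

variable {n d : ℕ} {G : SimpleGraph (Fin n)} {p : Config n d}

/-- The space of `l`-pinned configurations. -/
def pinnedSubmodule (n d l : ℕ) : Submodule ℝ (Config n d) where
  carrier := {q | IsPinnedAt l q}
  add_mem' ha hb i hi c hc := by
    simpa [point] using congrArg₂ (· + ·) (ha i hi c hc) (hb i hi c hc)
  zero_mem' _ _ _ _ := rfl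
  smul_mem' r a ha i hi c hc := by simpa [point] using congrArg (r * ·) (ha i hi c hc)

theorem IsTrajectory.analyticAt {γ : ℝ → Config n d} (h : IsTrajectory p γ) :
    AnalyticAt ℝ γ 0 := by
  obtain ⟨ε, hε, hγ, -⟩ := h
  exact hγ 0 ⟨le_rfl, hε.le⟩

theorem IsTrajectory.apply_zero {γ : ℝ → Config n d} (h : IsTrajectory p γ) : γ 0 = p := by
  obtain ⟨ε, -, -, hγ₀, -⟩ := h
  exact hγ₀

theorem IsTrajectory.tendsto {γ : ℝ → Config n d} (h : IsTrajectory p γ) :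
    Tendsto γ (𝓝 0) (𝓝 p) := by
  simpa only [h.apply_zero] using h.analyticAt.continuousAt.tendsto

theorem IsTrajectory.eventually_isPinnedAt {γ : ℝ → Config n d} (h : IsTrajectory p γ) :
    ∀ᶠ t in 𝓝[≥] 0, IsPinnedAt (spanDim p) (γ t) := by
  obtain ⟨ε, hε, -, -, hpin, -⟩ := h
  filter_upwards [Icc_mem_nhdsGE hε] with t ht using hpin t ht

theorem IsTrajectory.deriv_mem {γ : ℝ → Config n d} (h : IsTrajectory p γ) :
    deriv γ 0 ∈ pinnedSubmodule n d (spanDim p) := by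
  intro i hi c hc
  have hcoord : HasDerivAt (fun t => γ t (i, c)) (deriv γ 0 (i, c)) 0 :=
    (EuclideanSpace.proj (i, c) : Config n d →L[ℝ] ℝ).hasFDerivAt.comp_hasDerivAt 0
      h.analyticAt.differentiableAt.hasDerivAt
  have hzero : (fun t => γ t (i, c)) =ᶠ[𝓝[≥] 0] fun _ => 0 :=
    h.eventually_isPinnedAt.mono fun t ht => ht i hi c hc
  have hzero' : HasDerivWithinAt (fun t => γ t (i, c)) 0 (Ici 0) 0 :=
    (hasDerivWithinAt_const (0 : ℝ) (Ici 0) (0 : ℝ)).congr_of_eventuallyEq hzero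
      (hzero.self_of_nhdsWithin self_mem_Ici)
  exact (uniqueDiffWithinAt_Ici (0 : ℝ)).eq_deriv _ hcoord.hasDerivWithinAt hzero'

theorem isTrajectory_of_hasDerivAt {γ : ℝ → pinnedSubmodule n d (spanDim p)}
    (hγ : AnalyticAt ℝ γ 0) (hγ₀ : γ 0 = p) {v : pinnedSubmodule n d (spanDim p)}
    (hd : HasDerivAt γ v 0) (hv : v ≠ 0) : IsTrajectory p fun t => γ t := by
  obtain ⟨ε, hε, hball⟩ := Metric.nhds_basis_closedBall.eventually_iff.mp hγ.eventually_analyticAt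
  have hne : ∀ᶠ t in 𝓝[>] (0 : ℝ), (γ t : Config n d) ≠ p := by
    have : ∀ᶠ t in 𝓝[≠] (0 : ℝ), γ t ≠ γ 0 := hd.eventually_ne hv
    filter_upwards [nhdsGT_le_nhdsNE 0 this] with t ht hp
    exact ht (Subtype.ext (hp.trans hγ₀.symm))
  obtain ⟨t, ht, htε⟩ := (hne.and (Ioc_mem_nhdsGT hε)).exists
  refine ⟨ε, hε, fun s hs => ?_, hγ₀, fun s _ => (γ s).2, t, Ioc_subset_Icc_self htε, ht⟩
  refine ((pinnedSubmodule n d (spanDim p)).subtypeL.analyticAt _).fun_comp (hball ?_)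
  simpa [abs_of_nonneg hs.1] using hs.2

theorem isFlex_one_of_hasDerivAt {γ : ℝ → pinnedSubmodule n d (spanDim p)}
    (hγ : AnalyticAt ℝ γ 0) (hγ₀ : γ 0 = p) {v : pinnedSubmodule n d (spanDim p)}
    (hd : HasDerivAt γ v 0) (hv : v ≠ 0) {k : ℕ} (hk : 1 ≤ k)
    (hvan : ∀ e ∈ G.edgeSet, IsVanishing k fun t => edgeLength (γ t : Config n d) e ^ 2) :
    IsFlex G p 1 k fun t => γ t := by
  have hd' : HasDerivAt (fun t => (γ t : Config n d)) v 0 :=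
    (pinnedSubmodule n d (spanDim p)).subtypeL.hasFDerivAt.comp_hasDerivAt 0 hd
  refine ⟨le_rfl, hk, isTrajectory_of_hasDerivAt hγ hγ₀ hd hv, isActive_one_iff.mpr ?_, hvan⟩
  rw [hd'.deriv]
  simpa using hv

theorem fderiv_pinned_rigidityMap_apply (hp : IsPinnedAt (spanDim p) p)
    (v : pinnedSubmodule n d (spanDim p)) :
    fderiv ℝ (fun x : pinnedSubmodule n d (spanDim p) => rigidityMap G (x : Config n d)) ⟨p, hp⟩ v =
      fderiv ℝ (rigidityMap G) p v := by
  have := Fintype.ofFinite G.edgeSet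
  have hF := (analyticAt_rigidityMap (G := G) p).differentiableAt.hasFDerivAt
  have := HasFDerivAt.comp (⟨p, hp⟩ : pinnedSubmodule n d (spanDim p)) (g := rigidityMap G) hF
    (pinnedSubmodule n d (spanDim p)).subtypeL.hasFDerivAt
  exact DFunLike.congr_fun this.fderiv v

theorem firstOrderFlexes_eq_map_ker (hp : IsPinnedAt (spanDim p) p) :
    firstOrderFlexes G p = (LinearMap.ker (fderiv ℝ
      (fun x : pinnedSubmodule n d (spanDim p) => rigidityMap G (x : Config n d))
        ⟨p, hp⟩).toLinearMap).map (pinnedSubmodule n d (spanDim p)).subtype := by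
  refine le_antisymm (Submodule.span_le.mpr ?_) ?_
  · rintro _ ⟨γ, ⟨-, -, hγ, -, hvan⟩, rfl⟩
    rw [forall_isVanishing_one_iff_fderiv_eq_zero hγ.analyticAt.differentiableAt,
      hγ.apply_zero] at hvan
    exact ⟨⟨deriv γ 0, hγ.deriv_mem⟩, (fderiv_pinned_rigidityMap_apply hp _).trans hvan, rfl⟩
  · rintro _ ⟨v, hv, rfl⟩
    obtain rfl | hv₀ := eq_or_ne v 0
    · exact Submodule.zero_mem _
    let x₀ : pinnedSubmodule n d (spanDim p) := ⟨p, hp⟩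
    let γ : ℝ → pinnedSubmodule n d (spanDim p) := fun t => x₀ + t • v
    have hline : HasDerivAt (fun t : ℝ => t • v) v 0 := by
      simpa using (hasDerivAt_id (0 : ℝ)).smul_const v
    have hd : HasDerivAt γ v 0 := hline.const_add x₀
    have hγ : AnalyticAt ℝ γ 0 := analyticAt_const.add (analyticAt_id.smul analyticAt_const)
    have hγ₀ : (γ 0 : Config n d) = p := by simp [γ, x₀]
    have hd' : HasDerivAt (fun t => (γ t : Config n d)) v 0 :=
      (pinnedSubmodule n d (spanDim p)).subtypeL.hasFDerivAt.comp_hasDerivAt 0 hd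
    refine Submodule.subset_span ⟨fun t => γ t, isFlex_one_of_hasDerivAt hγ hγ₀ hd hv₀ le_rfl ?_,
      hd'.deriv⟩
    rw [forall_isVanishing_one_iff_fderiv_eq_zero hd'.differentiableAt, hd'.deriv, hγ₀,
      ← fderiv_pinned_rigidityMap_apply hp]
    exact hv

end Trajectories

section Energy

variable {n d : ℕ}

theorem isTheta_sq_sub_sq_sq_of_isLocalMin {f : ℝ → ℝ} {a : ℝ} (hf : AnalyticAt ℝ f a)
    (hmin : IsLocalMin f a) (hf₂ : iteratedDeriv 2 f a ≠ 0) (ha : a ≠ 0) :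
    (fun x => f x - f a) =Θ[𝓝 a] fun x => (x ^ 2 - a ^ 2) ^ 2 := by
  have hf' : AnalyticAt ℝ (fun x => f x - f a) a := hf.sub analyticAt_const
  have horder : analyticOrderAt (fun x => f x - f a) a = (2 : ℕ) := by
    refine (analyticOrderAt_eq_nat_iff_iteratedDeriv_eq_zero hf').mpr ⟨fun i hi => ?_, ?_⟩
    · obtain rfl | rfl : i = 0 ∨ i = 1 := by lia
      · simp only [iteratedDeriv_zero, sub_self]
      · rw [iteratedDeriv_sub_const one_ne_zero, iteratedDeriv_one, hmin.deriv_eq_zero]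
    · rwa [iteratedDeriv_sub_const two_ne_zero]
  have hsq : (fun x => x ^ 2 - a ^ 2) =Θ[𝓝 a] fun x => x - a :=
    isTheta_sub_of_hasDerivAt (hasDerivAt_pow 2 a) (by simpa using ha)
  exact (isTheta_pow_of_analyticOrderAt_eq hf' horder).trans (hsq.pow 2).symm

variable {G : SimpleGraph (Fin n)} {p : Config n d} {E : Sym2 (Fin n) → ℝ → ℝ}

theorem IsBarLike.isLocalMin (hE : IsBarLike G p E) {e : Sym2 (Fin n)} (he : e ∈ G.edgeSet) :
    IsLocalMin (E e) (edgeLength p e) := by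
  obtain ⟨-, -, hmin⟩ := hE e he
  filter_upwards [eventually_nhdsWithin_iff.mp hmin] with x hx
  obtain rfl | hne := eq_or_ne x (edgeLength p e)
  exacts [le_rfl, (hx hne).le]

theorem IsStiffBar.isTheta_edge (hE : IsStiffBar G p E) {e : Sym2 (Fin n)} (he : e ∈ G.edgeSet) :
    (fun q => E e (edgeLength q e) - E e (edgeLength p e)) =Θ[𝓝 p]
      fun q => (edgeLength q e ^ 2 - edgeLength p e ^ 2) ^ 2 := by
  have h := isTheta_sq_sub_sq_sq_of_isLocalMin (hE.1 e he).2.1 (hE.1.isLocalMin he)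
    (hE.2 e he).ne' (hE.1 e he).1
  have hlen : Tendsto (fun q => edgeLength q e) (𝓝 p) (𝓝 (edgeLength p e)) :=
    (continuous_edgeLength e).tendsto p
  exact ⟨h.1.comp_tendsto hlen, h.2.comp_tendsto hlen⟩

variable [DecidableRel G.Adj]

theorem energy_sub_energy (E : Sym2 (Fin n) → ℝ → ℝ) (p q : Config n d) :
    energy G E q - energy G E p =
      ∑ e ∈ G.edgeFinset, (E e (edgeLength q e) - E e (edgeLength p e)) :=
  (Finset.sum_sub_distrib _ _).symm

theorem IsBarLike.eventually_forall_edge_le (hE : IsBarLike G p E) :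
    ∀ᶠ q in 𝓝 p, ∀ e ∈ G.edgeFinset, 0 ≤ E e (edgeLength q e) - E e (edgeLength p e) := by
  refine (Filter.eventually_all_finset _).mpr fun e he => ?_
  filter_upwards [((continuous_edgeLength e).tendsto p).eventually
    (hE.isLocalMin (SimpleGraph.mem_edgeFinset.mp he))] with q hq using sub_nonneg.mpr hq

theorem IsStiffBar.isTheta_energy (hE : IsStiffBar G p E) :
    (fun q => energy G E q - energy G E p) =Θ[𝓝 p]
      fun q => ‖rigidityMap G q - rigidityMap G p‖ ^ 2 := by
  have hcomp (e : G.edgeSet) (q : Config n d) :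
      (rigidityMap G q - rigidityMap G p) e = edgeLength q e ^ 2 - edgeLength p e ^ 2 := rfl
  simp only [energy_sub_energy]
  refine ⟨IsBigO.fun_sum fun e he => ?_, ?_⟩
  · have he' := SimpleGraph.mem_edgeFinset.mp he
    refine (hE.isTheta_edge he').1.trans (IsBigO.pow (IsBigO.of_bound' (.of_forall fun q => ?_)) 2)
    rw [← hcomp ⟨e, he'⟩, norm_norm]
    exact norm_le_pi_norm _ _
  · have hnonneg := hE.1.eventually_forall_edge_le.mono fun q hq => Finset.sum_nonneg hq
    have hsqrt : (fun q => rigidityMap G q - rigidityMap G p) =O[𝓝 p]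
        fun q => √(∑ e ∈ G.edgeFinset, (E e (edgeLength q e) - E e (edgeLength p e))) := by
      refine isBigO_pi.mpr fun e => ?_
      have hedge : (fun q => (rigidityMap G q - rigidityMap G p) e ^ 2) =O[𝓝 p]
          fun q => ∑ e ∈ G.edgeFinset, (E e (edgeLength q e) - E e (edgeLength p e)) := by
        refine (hE.isTheta_edge e.2).2.trans (IsBigO.of_norm_eventuallyLE ?_)
        filter_upwards [hE.1.eventually_forall_edge_le] with q hq
        rw [Real.norm_of_nonneg (hq e (SimpleGraph.mem_edgeFinset.mpr e.2))]
        exact Finset.single_le_sum hq (SimpleGraph.mem_edgeFinset.mpr e.2)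
      simpa only [Real.sqrt_sq_eq_abs, isBigO_abs_left] using hedge.sqrt hnonneg
    refine (hsqrt.norm_left.pow 2).trans_eventuallyEq ?_
    filter_upwards [hnonneg] with q hq using Real.sq_sqrt hq

end Energy

section CoordinateFlag

variable {d : ℕ}

/-- The span of the first `r` coordinate vectors, encoded by the vanishing of all other
coordinates so that `IsPinnedAt` becomes membership. -/
def coordSpace (d r : ℕ) : Submodule ℝ (EuclideanSpace ℝ (Fin d)) where
  carrier := {x | ∀ c : Fin d, r ≤ c → x c = 0}
  add_mem' ha hb c hc := by simp [ha c hc, hb c hc]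
  zero_mem' _ _ := rfl
  smul_mem' a x hx c hc := by simp [hx c hc]

theorem coordSpace_mono : Monotone (coordSpace d) :=
  fun _ _ h _ hx c hc => hx c (h.trans hc)

theorem single_mem_coordSpace_iff {r : ℕ} {c : Fin d} :
    EuclideanSpace.single c (1 : ℝ) ∈ coordSpace d r ↔ (c : ℕ) < r := by
  refine ⟨fun h => ?_, fun hc b hb => ?_⟩
  · by_contra! hr
    simpa using h c hr
  · have : b ≠ c := by rintro rfl; exact hc.not_ge hb
    simpa using this

theorem finrank_coordSpace_le (r : ℕ) : Module.finrank ℝ (coordSpace d r) ≤ r := by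
  have hle : coordSpace d r ≤ Submodule.span ℝ
      ((Finset.univ.filter fun c : Fin d => (c : ℕ) < r).image
        fun c => EuclideanSpace.single c (1 : ℝ) : Set (EuclideanSpace ℝ (Fin d))) := by
    intro x hx
    rw [← (EuclideanSpace.basisFun (Fin d) ℝ).sum_repr x]
    refine Submodule.sum_mem _ fun c _ => ?_
    by_cases hc : (c : ℕ) < r
    · refine Submodule.smul_mem _ _ (Submodule.subset_span ?_)
      simpa using ⟨c, hc, rfl⟩
    · simp [hx c (not_lt.mp hc)]
  refine (Submodule.finrank_mono hle).trans ((finrank_span_finset_le_card _).trans ?_)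
  refine Finset.card_image_le.trans ?_
  rw [Fin.card_filter_val_lt]
  exact min_le_right _ _

theorem linearIndependent_of_mem_coordSpace_succ {f : Fin d → EuclideanSpace ℝ (Fin d)}
    (hf : ∀ c : Fin d, f c ∈ coordSpace d (c + 1)) (hdiag : ∀ c, f c c ≠ 0) :
    LinearIndependent ℝ f := by
  let M : Matrix (Fin d) (Fin d) ℝ := fun b c => f b c
  have hM : M.IsLowerTriangular := fun b c hbc => hf b c hbc
  have hdet : M.det ≠ 0 := by
    rw [Matrix.det_of_isLowerTriangular M hM]
    exact Finset.prod_ne_zero_iff.mpr fun c _ => hdiag c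
  exact LinearIndependent.of_comp (WithLp.linearEquiv 2 ℝ (Fin d → ℝ)).toLinearMap
    (Matrix.linearIndependent_rows_of_det_ne_zero hdet)

end CoordinateFlag

section PinnedPosition

variable {n d : ℕ} {p q : Config n d}

theorem IsPinnedAt.point_mem_coordSpace {l : ℕ} (h : IsPinnedAt l q) {i : Fin n}
    (hi : (i : ℕ) ≤ l) : point q i ∈ coordSpace d i :=
  h i hi

theorem IsPinnedAt.point_zero [NeZero n] {l : ℕ} (h : IsPinnedAt l q) : point q 0 = 0 := by
  ext c
  exact h 0 (Nat.zero_le l) c (Nat.zero_le c)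

theorem spanDim_lt [NeZero n] (p : Config n d) : spanDim p < n := by
  have := finrank_vectorSpan_range_le ℝ (fun i : Fin n => point p i) (n := n - 1)
    (by simp [Nat.sub_add_cancel NeZero.one_le])
  exact this.trans_lt (Nat.sub_one_lt (NeZero.ne n))

theorem IsNondegenerate.le_finrank_span_initial [NeZero n] (hp : IsNondegenerate p) {r : ℕ}
    (hr : r ≤ spanDim p) :
    r ≤ Module.finrank ℝ (Submodule.span ℝ (point p '' {i | (i : ℕ) ≤ r})) := by
  have hrn : r < n := hr.trans_lt (spanDim_lt p)
  let f : Fin (r + 1) ↪ {i : Fin n // (i : ℕ) ≤ spanDim p} :=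
    ⟨fun j => ⟨⟨j, by lia⟩, by lia⟩, fun a b hab => by simpa [Fin.ext_iff] using hab⟩
  have hle : vectorSpan ℝ (range fun j => point p (f j)) ≤
      Submodule.span ℝ (point p '' {i | (i : ℕ) ≤ r}) := by
    rw [vectorSpan_def, Submodule.span_le]
    rintro _ ⟨_, ⟨i, rfl⟩, _, ⟨j, rfl⟩, rfl⟩
    exact Submodule.sub_mem _ (Submodule.subset_span ⟨_, Nat.lt_succ_iff.mp i.2, rfl⟩)
      (Submodule.subset_span ⟨_, Nat.lt_succ_iff.mp j.2, rfl⟩)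
  have hdim : Module.finrank ℝ (vectorSpan ℝ (range fun j => point p (f j))) = r :=
    (AffineIndependent.comp_embedding f hp).finrank_vectorSpan (by simp)
  exact hdim.ge.trans (Submodule.finrank_mono hle)

theorem IsPinned.span_initial [NeZero n] (hp : IsPinned p) {r : ℕ} (hr : r ≤ spanDim p) :
    Submodule.span ℝ (point p '' {i | (i : ℕ) ≤ r}) = coordSpace d r := by
  refine Submodule.eq_of_le_of_finrank_le (Submodule.span_le.mpr ?_)
    ((finrank_coordSpace_le r).trans (hp.1.le_finrank_span_initial hr))
  rintro _ ⟨i, hi, rfl⟩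
  exact coordSpace_mono hi (hp.2.point_mem_coordSpace (hi.trans hr))

theorem IsPinned.point_apply_ne_zero [NeZero n] (hp : IsPinned p) {i : Fin n} {c : Fin d}
    (hic : (i : ℕ) = c + 1) (hi : (i : ℕ) ≤ spanDim p) : point p i c ≠ 0 := by
  intro h₀
  have hle : coordSpace d i ≤ coordSpace d c := by
    rw [← hp.span_initial hi, Submodule.span_le]
    rintro _ ⟨j, hj, rfl⟩ b hb
    obtain hjc | hjc := le_or_gt (j : ℕ) c
    · exact hp.2 j (hjc.trans (by lia)) b (hjc.trans hb)
    obtain rfl : j = i := Fin.ext (le_antisymm hj (hic.trans_le hjc))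
    obtain hbc | hbc := hb.eq_or_lt
    · rwa [← Fin.ext hbc]
    · exact hp.2 j hi b (hic.trans_le hbc)
  have : (c : ℕ) < c := single_mem_coordSpace_iff.mp
    (hle (single_mem_coordSpace_iff.mpr (hic ▸ Nat.lt_succ_self (c : ℕ))))
  exact this.false

theorem IsPinned.point_mem_coordSpace [NeZero n] (hp : IsPinned p) (i : Fin n) :
    point p i ∈ coordSpace d (spanDim p) := by
  have hle : coordSpace d (spanDim p) ≤ vectorSpan ℝ (range fun i => point p i) := by
    rw [← hp.span_initial le_rfl, Submodule.span_le]
    rintro _ ⟨j, -, rfl⟩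
    simpa [hp.2.point_zero] using
      vsub_mem_vectorSpan ℝ (mem_range_self (f := point p) j) (mem_range_self (0 : Fin n))
  have heq : coordSpace d (spanDim p) = vectorSpan ℝ (range fun i => point p i) := by
    refine Submodule.eq_of_le_of_finrank_le hle ?_
    rw [← hp.span_initial le_rfl]
    exact hp.1.le_finrank_span_initial le_rfl
  rw [heq]
  simpa [hp.2.point_zero] using
    vsub_mem_vectorSpan ℝ (mem_range_self (f := point p) i) (mem_range_self (0 : Fin n))

end PinnedPosition

section Uniqueness

variable {n d : ℕ} {p q : Config n d}

theorem IsCongruent.norm_point_eq [NeZero n] (h : IsCongruent p q) {l : ℕ} (hp : IsPinnedAt l p)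
    (hq : IsPinnedAt l q) (i : Fin n) : ‖point p i‖ = ‖point q i‖ := by
  simpa only [hp.point_zero, hq.point_zero, sub_zero] using h i 0

theorem IsCongruent.inner_point_sub_eq_zero [NeZero n] (h : IsCongruent p q) {l : ℕ}
    (hp : IsPinnedAt l p) (hq : IsPinnedAt l q) {j : Fin n} (hj : point q j = point p j)
    (i : Fin n) : inner ℝ (point p j) (point q i - point p i) = 0 := by
  have hinner : inner ℝ (point p j) (point p i) = inner ℝ (point q j) (point q i) := by
    simp only [real_inner_eq_norm_mul_self_add_norm_mul_self_sub_norm_sub_mul_self_div_two,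
      h.norm_point_eq hp hq, h j i]
  rw [inner_sub_right, hinner, hj, sub_self]

theorem IsPinned.inner_eq_zero_of_mem_coordSpace [NeZero n] (hp : IsPinned p) {r : ℕ}
    (hr : r ≤ spanDim p) {x : EuclideanSpace ℝ (Fin d)}
    (hx : ∀ j : Fin n, (j : ℕ) ≤ r → inner ℝ (point p j) x = 0) {y : EuclideanSpace ℝ (Fin d)}
    (hy : y ∈ coordSpace d r) : inner ℝ y x = 0 := by
  have hle : coordSpace d r ≤ (ℝ ∙ x)ᗮ := by
    rw [← hp.span_initial hr, Submodule.span_le]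
    rintro _ ⟨j, hj, rfl⟩
    exact Submodule.mem_orthogonal_singleton_iff_inner_left.mpr (hx j hj)
  exact Submodule.mem_orthogonal_singleton_iff_inner_left.mp (hle hy)

theorem IsPinned.point_eq_of_le_spanDim [NeZero n] (hp : IsPinned p)
    (hq : IsPinnedAt (spanDim p) q) (hcong : IsCongruent p q) {i : Fin n} (hi : (i : ℕ) ≤ spanDim p)
    (hlt : ∀ j < i, point q j = point p j)
    (hdiag : ∀ c, p (i, c) ≠ 0 → q (i, c) + p (i, c) ≠ 0) :
    point q i = point p i := by
  have hdiff (c : Fin d) (hc : (c : ℕ) + 1 ≠ i) : point q i c = point p i c := by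
    obtain hci | hci := le_or_gt (i : ℕ) c
    · rw [hq i hi c hci, hp.2 i hi c hci]
    · have hmem : EuclideanSpace.single c (1 : ℝ) ∈ coordSpace d (i - 1) :=
        single_mem_coordSpace_iff.mpr (by lia)
      have horth := hp.inner_eq_zero_of_mem_coordSpace (by lia)
        (fun j hj => hcong.inner_point_sub_eq_zero hp.2 hq
          (hlt j (Fin.lt_def.mpr (by lia))) i) hmem
      simpa [EuclideanSpace.inner_single_left, sub_eq_zero] using horth
  ext c
  by_cases hc : (c : ℕ) + 1 = i
  · have hnorm : ‖point q i‖ ^ 2 = ‖point p i‖ ^ 2 := by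
      rw [hcong.norm_point_eq hp.2 hq]
    rw [EuclideanSpace.real_norm_sq_eq, EuclideanSpace.real_norm_sq_eq, ← sub_eq_zero,
      ← Finset.sum_sub_distrib, Finset.sum_eq_single c, sq_sub_sq] at hnorm
    · exact sub_eq_zero.mp ((mul_eq_zero.mp hnorm).resolve_left
        (hdiag c (hp.point_apply_ne_zero hc.symm hi)))
    · intro b _ hb
      rw [hdiff b fun hbi => hb (Fin.ext (by lia)), sub_self]
    · exact fun h => absurd (Finset.mem_univ c) h
  · exact hdiff c hc

theorem IsPinned.point_eq_of_initial_eq [NeZero n] (hp : IsPinned p)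
    (hq : IsPinnedAt (spanDim p) q) (hcong : IsCongruent p q)
    (hinitial : ∀ j : Fin n, (j : ℕ) ≤ spanDim p → point q j = point p j) (i : Fin n) :
    point q i = point p i := by
  have horth : inner ℝ (point p i) (point q i - point p i) = 0 :=
    hp.inner_eq_zero_of_mem_coordSpace le_rfl
      (fun j hj => hcong.inner_point_sub_eq_zero hp.2 hq (hinitial j hj) i)
      (hp.point_mem_coordSpace i)
  have hnorm := hcong.norm_point_eq hp.2 hq i
  refine (eq_of_norm_le_re_inner_eq_norm_sq (𝕜 := ℝ) hnorm.le ?_).symm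
  rw [inner_sub_right, real_inner_self_eq_norm_sq, sub_eq_zero] at horth
  rw [RCLike.re_to_real, horth, hnorm]

theorem IsPinned.eventually_eq_of_isCongruent [NeZero n] (hp : IsPinned p) :
    ∀ᶠ q in 𝓝 p, IsPinnedAt (spanDim p) q → IsCongruent p q → q = p := by
  have hdiag : ∀ᶠ q : Config n d in 𝓝 p, ∀ i c, p (i, c) ≠ 0 → q (i, c) + p (i, c) ≠ 0 := by
    simp only [eventually_all]
    intro i c hne
    have hcont : ContinuousAt (fun q : Config n d => q (i, c) + p (i, c)) p := by fun_prop
    exact hcont.eventually_ne (by simpa using hne)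
  filter_upwards [hdiag] with q hdiag hq hcong
  have hinitial : ∀ i : Fin n, (i : ℕ) ≤ spanDim p → point q i = point p i := by
    intro i hi
    induction i using WellFoundedLT.induction with
    | _ i ih =>
      exact hp.point_eq_of_le_spanDim hq hcong hi
        (fun j hj => ih j hj ((Fin.lt_def.mp hj).le.trans hi)) (hdiag i)
  ext ⟨i, c⟩
  exact congrArg (fun x : EuclideanSpace ℝ (Fin d) => x c)
    (hp.point_eq_of_initial_eq hq hcong hinitial i)

end Uniqueness

section GramSchmidt

variable {𝕜 E X ι : Type*} [RCLike 𝕜] [NormedAddCommGroup E] [InnerProductSpace 𝕜 E]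
  [TopologicalSpace X] [LinearOrder ι] [LocallyFiniteOrderBot ι] [WellFoundedLT ι]
  {f : X → ι → E} {x : X}

theorem continuousAt_gramSchmidt (hf : ∀ i, ContinuousAt (fun y => f y i) x)
    (hind : LinearIndependent 𝕜 (f x)) (i : ι) :
    ContinuousAt (fun y => gramSchmidt 𝕜 (f y) i) x := by
  induction i using WellFoundedLT.induction with
  | _ i ih =>
    simp only [gramSchmidt_def 𝕜 _ i, Submodule.starProjection_singleton]
    refine (hf i).sub (tendsto_finsetSum _ fun j hj => ?_)
    have hj := ih j (Finset.mem_Iio.mp hj)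
    refine ((hj.inner (hf i)).div ?_ ?_).smul hj
    · exact RCLike.continuous_ofReal.continuousAt.comp (hj.norm.pow 2)
    · simpa using gramSchmidt_ne_zero (𝕜 := 𝕜) j hind

theorem gramSchmidtNormed_ne_zero {f : ι → E} {i : ι} (h : gramSchmidt 𝕜 f i ≠ 0) :
    gramSchmidtNormed 𝕜 f i ≠ 0 := by
  simpa [gramSchmidtNormed] using h

theorem continuousAt_gramSchmidtOrthonormalBasis [Fintype ι] [FiniteDimensional 𝕜 E]
    (h : Module.finrank 𝕜 E = Fintype.card ι) (hf : ∀ i, ContinuousAt (fun y => f y i) x)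
    (hind : LinearIndependent 𝕜 (f x)) (i : ι) :
    ContinuousAt (fun y => gramSchmidtOrthonormalBasis h (f y) i) x := by
  have hgs := continuousAt_gramSchmidt hf hind i
  have hne := gramSchmidt_ne_zero (𝕜 := 𝕜) i hind
  have hnormed : ContinuousAt (fun y => gramSchmidtNormed 𝕜 (f y) i) x := by
    refine ContinuousAt.smul (ContinuousAt.inv₀ ?_ (by simpa using hne)) hgs
    exact RCLike.continuous_ofReal.continuousAt.comp hgs.norm
  refine hnormed.congr ?_
  filter_upwards [hgs.eventually_ne hne] with y hy
  exact (gramSchmidtOrthonormalBasis_apply h (gramSchmidtNormed_ne_zero hy)).symm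

end GramSchmidt

section Pinning

variable {n d : ℕ} [NeZero n] {p : Config n d}

/-- The vectors from the first point of `q` to the next `l` ones, completed by coordinate vectors
to a family of `d` vectors. Orthonormalizing it pins `q`. -/
noncomputable def pinningFrame (l : ℕ) (q : Config n d) (c : Fin d) : EuclideanSpace ℝ (Fin d) :=
  if (c : ℕ) < l then point q (Fin.ofNat n (c + 1)) - point q 0 else EuclideanSpace.single c 1

theorem pinningFrame_of_eq_succ {l : ℕ} (q : Config n d) {i : Fin n} {c : Fin d}
    (hic : (i : ℕ) = c + 1) (hi : (i : ℕ) ≤ l) : pinningFrame l q c = point q i - point q 0 := by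
  rw [pinningFrame, if_pos (by lia), ← hic, Fin.ofNat_val_eq_self]

theorem pinningFrame_of_le {l : ℕ} (q : Config n d) {c : Fin d} (hc : l ≤ c) :
    pinningFrame l q c = EuclideanSpace.single c 1 :=
  if_neg hc.not_gt

theorem continuous_pinningFrame (l : ℕ) (c : Fin d) :
    Continuous fun q : Config n d => pinningFrame l q c := by
  unfold pinningFrame
  split_ifs
  exacts [(continuous_point _).sub (continuous_point _), continuous_const]

theorem IsPinned.pinningFrame_mem (hp : IsPinned p) (c : Fin d) :
    pinningFrame (spanDim p) p c ∈ coordSpace d (c + 1) := by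
  obtain hc | hc := lt_or_ge (c : ℕ) (spanDim p)
  · obtain ⟨i, hic⟩ : ∃ i : Fin n, (i : ℕ) = c + 1 :=
      ⟨⟨c + 1, Nat.lt_of_le_of_lt hc (spanDim_lt p)⟩, rfl⟩
    rw [pinningFrame_of_eq_succ p hic (by lia), hp.2.point_zero, sub_zero]
    exact hic ▸ hp.2.point_mem_coordSpace (by lia)
  · rw [pinningFrame_of_le p hc]
    exact single_mem_coordSpace_iff.mpr c.1.lt_succ_self

theorem IsPinned.linearIndependent_pinningFrame (hp : IsPinned p) :
    LinearIndependent ℝ (pinningFrame (spanDim p) p) := by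
  refine linearIndependent_of_mem_coordSpace_succ hp.pinningFrame_mem fun c => ?_
  obtain hc | hc := lt_or_ge (c : ℕ) (spanDim p)
  · obtain ⟨i, hic⟩ : ∃ i : Fin n, (i : ℕ) = c + 1 :=
      ⟨⟨c + 1, Nat.lt_of_le_of_lt hc (spanDim_lt p)⟩, rfl⟩
    rw [pinningFrame_of_eq_succ p hic (by lia), hp.2.point_zero, sub_zero]
    exact hp.point_apply_ne_zero hic (by lia)
  · simp [pinningFrame_of_le p hc]

/-- An orthonormal basis adapted to the flag spanned by the first points of `q`, seen from the
first one. -/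
noncomputable def pinningBasis (l : ℕ) (q : Config n d) :
    OrthonormalBasis (Fin d) ℝ (EuclideanSpace ℝ (Fin d)) :=
  gramSchmidtOrthonormalBasis finrank_euclideanSpace (pinningFrame l q)

theorem inner_pinningBasis_eq_zero {l : ℕ} (q : Config n d) {i : Fin n} (hi : (i : ℕ) ≤ l)
    {c : Fin d} (hic : (i : ℕ) ≤ c) : inner ℝ (pinningBasis l q c) (point q i - point q 0) = 0 := by
  obtain rfl | hi₀ := eq_or_ne i 0
  · rw [sub_self, inner_zero_right]
  obtain ⟨b, hb⟩ := Nat.exists_eq_succ_of_ne_zero (Fin.val_ne_zero_iff.mpr hi₀)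
  have hbc : b < c := by lia
  rw [← pinningFrame_of_eq_succ q (c := ⟨b, hbc.trans c.2⟩) hb hi]
  exact gramSchmidtOrthonormalBasis_inv_triangular _ _ hbc

theorem IsPinned.pinningBasis_mem (hp : IsPinned p) (c : Fin d) :
    pinningBasis (spanDim p) p c ∈ coordSpace d (c + 1) := by
  rw [pinningBasis, gramSchmidtOrthonormalBasis_apply _
    (gramSchmidtNormed_ne_zero (gramSchmidt_ne_zero c hp.linearIndependent_pinningFrame))]
  refine Submodule.smul_mem _ _ (Submodule.span_le.mpr ?_ (gramSchmidt_mem_span ℝ _ le_rfl))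
  rintro _ ⟨b, hb, rfl⟩
  exact coordSpace_mono (Nat.succ_le_succ hb) (hp.pinningFrame_mem b)

/-- The isometry taking the adapted basis of `q` to that of `p`. -/
noncomputable def pinningIsometry (p q : Config n d) :
    EuclideanSpace ℝ (Fin d) ≃ₗᵢ[ℝ] EuclideanSpace ℝ (Fin d) :=
  (pinningBasis (spanDim p) q).repr.trans (pinningBasis (spanDim p) p).repr.symm

theorem pinningIsometry_apply (p q : Config n d) (x : EuclideanSpace ℝ (Fin d)) :
    pinningIsometry p q x =
      ∑ c, inner ℝ (pinningBasis (spanDim p) q c) x • pinningBasis (spanDim p) p c := by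
  simp only [← OrthonormalBasis.repr_apply_apply, OrthonormalBasis.sum_repr_symm, pinningIsometry,
    LinearIsometryEquiv.trans_apply]

/-- The congruent copy of `q` in the same pinned position as `p`. -/
noncomputable def pinning (p q : Config n d) : Config n d :=
  WithLp.toLp 2 fun x => pinningIsometry p q (point q x.1 - point q 0) x.2

theorem point_pinning (p q : Config n d) (i : Fin n) :
    point (pinning p q) i = pinningIsometry p q (point q i - point q 0) := rfl

theorem isCongruent_pinning (p q : Config n d) : IsCongruent q (pinning p q) := by
  intro i j
  rw [point_pinning, point_pinning, ← map_sub, LinearIsometryEquiv.norm_map,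
    sub_sub_sub_cancel_right]

theorem IsPinned.isPinnedAt_pinning (hp : IsPinned p) (q : Config n d) :
    IsPinnedAt (spanDim p) (pinning p q) := by
  intro i hi
  suffices point (pinning p q) i ∈ coordSpace d i from this
  rw [point_pinning, pinningIsometry_apply]
  refine Submodule.sum_mem _ fun c _ => ?_
  obtain hc | hc := lt_or_ge (c : ℕ) i
  · exact Submodule.smul_mem _ _ (coordSpace_mono hc (hp.pinningBasis_mem c))
  · rw [inner_pinningBasis_eq_zero q hi hc, zero_smul]
    exact Submodule.zero_mem _

theorem IsPinned.pinning_self (hp : IsPinned p) : pinning p p = p := by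
  have hpoint (i : Fin n) : point (pinning p p) i = point p i := by
    simp [point_pinning, pinningIsometry, hp.2.point_zero]
  ext ⟨i, c⟩
  exact congrArg (fun x : EuclideanSpace ℝ (Fin d) => x c) (hpoint i)

theorem IsPinned.continuousAt_pinning (hp : IsPinned p) : ContinuousAt (pinning p) p := by
  have hbasis (c : Fin d) : ContinuousAt (fun q => pinningBasis (spanDim p) q c) p :=
    continuousAt_gramSchmidtOrthonormalBasis _
      (fun b => (continuous_pinningFrame (spanDim p) b).continuousAt)
      hp.linearIndependent_pinningFrame c
  have hpoint (i : Fin n) : ContinuousAt (fun q => point (pinning p q) i) p := by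
    simp only [point_pinning, pinningIsometry_apply]
    exact tendsto_finsetSum _ fun c _ => ((hbasis c).inner (𝕜 := ℝ)
      ((continuous_point i).sub (continuous_point 0)).continuousAt).smul_const _
  refine (PiLp.continuous_toLp 2 _).continuousAt.comp (continuousAt_pi.mpr fun x => ?_)
  exact (EuclideanSpace.proj x.2 : EuclideanSpace ℝ (Fin d) →L[ℝ] ℝ).continuous.continuousAt.comp
    (hpoint x.1)

end Pinning

section FirstOrderRigidity

variable {n d : ℕ} {G : SimpleGraph (Fin n)} {p q : Config n d}

theorem IsCongruent.isEquivalent (h : IsCongruent p q) : IsEquivalent G p q :=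
  fun e _ => e.ind h

theorem IsPinned.isRigid_of_eventually_eq [NeZero n] (hp : IsPinned p)
    (h : ∀ᶠ q in 𝓝 p, IsPinnedAt (spanDim p) q → IsEquivalent G p q → q = p) : IsRigid G p := by
  have hpinning : Tendsto (pinning p) (𝓝 p) (𝓝 p) := by
    simpa only [ContinuousAt, hp.pinning_self] using hp.continuousAt_pinning
  refine ⟨_, hpinning h, fun q hq hequiv => ?_⟩
  have hcong := isCongruent_pinning p q
  have hself : pinning p q = p := hq (hp.isPinnedAt_pinning q)
    fun e he => (hequiv e he).trans (hcong.isEquivalent e he)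
  exact fun i j => ((hself ▸ hcong) i j).symm

theorem IsPinned.isFlexible_of_hasDerivAt [NeZero n] (hp : IsPinned p) {γ : ℝ → Config n d}
    {v : Config n d} (hγ₀ : γ 0 = p) (hd : HasDerivAt γ v 0) (hv : v ≠ 0)
    (hpin : ∀ t, IsPinnedAt (spanDim p) (γ t)) (hequiv : ∀ᶠ t in 𝓝 0, IsEquivalent G p (γ t)) :
    IsFlexible G p := by
  rintro ⟨U, hU, hrigid⟩
  have hcont : Tendsto γ (𝓝 0) (𝓝 p) := hγ₀ ▸ hd.continuousAt.tendsto
  have heq : ∀ᶠ t in 𝓝 0, γ t = p := by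
    filter_upwards [hcont hU, hequiv, hcont hp.eventually_eq_of_isCongruent] with t htU hte htp
    exact htp (hpin t) (hrigid _ htU hte)
  have hne : ∀ᶠ t in 𝓝[≠] (0 : ℝ), γ t ≠ p := hd.eventually_ne hv
  obtain ⟨t, hte, htne⟩ := ((heq.filter_mono nhdsWithin_le_nhds).and hne).exists
  exact htne hte

theorem HasFlex.of_le {j k k' : ℕ} (h : HasFlex G p j k) (hk' : 1 ≤ k') (hle : k' ≤ k) :
    HasFlex G p j k' := by
  obtain ⟨γ, hj, -, htraj, hactive, hvan⟩ := h
  exact ⟨γ, hj, hk', htraj, hactive, fun e he => (hvan e he).of_le hle⟩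

theorem IsFlex.isTheta_sub {k : ℕ} {γ : ℝ → Config n d} (h : IsFlex G p 1 k γ) :
    (fun t => γ t - p) =Θ[𝓝 0] fun t => t := by
  obtain ⟨-, -, htraj, hactive, -⟩ := h
  simpa only [htraj.apply_zero, sub_zero] using isTheta_sub_of_hasDerivAt
    htraj.analyticAt.differentiableAt.hasDerivAt (isActive_one_iff.mp hactive)

theorem IsFlex.rigidityMap_sub_isBigO [Fintype G.edgeSet] {j k : ℕ} {γ : ℝ → Config n d}
    (h : IsFlex G p j k γ) :
    (fun t => rigidityMap G (γ t) - rigidityMap G p) =O[𝓝 0] fun t => t ^ (k + 1) := by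
  obtain ⟨-, -, htraj, -, hvan⟩ := h
  simpa only [htraj.apply_zero] using (forall_isVanishing_iff_isBigO htraj.analyticAt).mp hvan

end FirstOrderRigidity

section ErrorBound

variable {n d : ℕ} {G : SimpleGraph (Fin n)} {p : Config n d}

/-- The squared edge lengths detect displacements in pinned position at order `m`. -/
def HasErrorBound (G : SimpleGraph (Fin n)) [Fintype G.edgeSet] (p : Config n d) (m : ℕ) : Prop :=
  (fun q => ‖q - p‖ ^ m) =O[𝓝[{q | IsPinnedAt (spanDim p) q}] p]
    fun q => rigidityMap G q - rigidityMap G p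

theorem HasErrorBound.isRigid [Fintype G.edgeSet] [NeZero n] {m : ℕ} (h : HasErrorBound G p m)
    (hp : IsPinned p) : IsRigid G p := by
  refine hp.isRigid_of_eventually_eq ?_
  filter_upwards [eventually_nhdsWithin_iff.mp h.eq_zero_imp] with q hq hpin hequiv
  have hpow := hq hpin (sub_eq_zero.mpr (isEquivalent_iff_rigidityMap_eq.mp hequiv).symm)
  simpa [sub_eq_zero] using eq_zero_of_pow_eq_zero hpow

theorem HasErrorBound.succ_le [Fintype G.edgeSet] {m k : ℕ} (h : HasErrorBound G p m)
    (hflex : HasFlex G p 1 k) : k + 1 ≤ m := by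
  obtain ⟨γ, hγ⟩ := hflex
  have htraj : IsTrajectory p γ := hγ.2.2.1
  have hright : 𝓝[>] (0 : ℝ) ≤ 𝓝 0 := nhdsWithin_le_nhds
  have hγp : Tendsto γ (𝓝[>] 0) (𝓝[{q | IsPinnedAt (spanDim p) q}] p) :=
    tendsto_nhdsWithin_iff.mpr ⟨htraj.tendsto.mono_left hright,
      htraj.eventually_isPinnedAt.filter_mono (nhdsWithin_mono _ Ioi_subset_Ici_self)⟩
  have hpow : (fun t : ℝ => t ^ m) =O[𝓝[>] 0] fun t => t ^ (k + 1) :=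
    calc (fun t : ℝ => t ^ m) =O[𝓝[>] 0] fun t => ‖γ t - p‖ ^ m :=
          (hγ.isTheta_sub.2.norm_right.pow m).mono hright
      _ =O[𝓝[>] 0] fun t => rigidityMap G (γ t) - rigidityMap G p := h.comp_tendsto hγp
      _ =O[𝓝[>] 0] fun t => t ^ (k + 1) := hγ.rigidityMap_sub_isBigO.mono hright
  exact le_of_sub_pow_isBigO_sub_pow (nhdsGT_le_nhdsNE (0 : ℝ)) (by simpa only [sub_zero])

variable [DecidableRel G.Adj] {E : Sym2 (Fin n) → ℝ → ℝ}

theorem HasErrorBound.growsQuickly {m : ℕ} (h : HasErrorBound G p m) (hE : IsStiffBar G p E) :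
    GrowsQuickly (energy G E) p (2 * m : ℕ) := by
  have hbound : (fun q => ‖q - p‖ ^ (2 * m)) =O[𝓝[{q | IsPinnedAt (spanDim p) q}] p]
      fun q => energy G E q - energy G E p := by
    simp only [mul_comm 2 m, pow_mul]
    exact (h.norm_right.pow 2).trans (hE.isTheta_energy.2.mono nhdsWithin_le_nhds)
  obtain ⟨c, hc, hbound⟩ := hbound.exists_pos
  refine ⟨c⁻¹, inv_pos.mpr hc, _, (eventually_nhdsWithin_iff.mp hbound.bound).and
    hE.1.eventually_forall_edge_le, fun q ⟨hq, hnonneg⟩ hpin => ?_⟩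
  have henergy : 0 ≤ energy G E q - energy G E p := by
    rw [energy_sub_energy]
    exact Finset.sum_nonneg hnonneg
  rw [Real.rpow_natCast, inv_mul_le_iff₀ hc]
  simpa only [norm_pow, norm_norm, Real.norm_of_nonneg henergy] using hq hpin

theorem HasFlex.growsSlowly {k : ℕ} (h : HasFlex G p 1 k) (hE : IsStiffBar G p E) :
    GrowsSlowly (energy G E) p (2 * (k + 1) : ℕ) := by
  obtain ⟨γ, hγ⟩ := h
  have htraj : IsTrajectory p γ := hγ.2.2.1
  have hbound : (fun t => energy G E (γ t) - energy G E p) =O[𝓝 0]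
      fun t => ‖γ t - p‖ ^ (2 * (k + 1)) :=
    calc (fun t => energy G E (γ t) - energy G E p) =O[𝓝 0]
          fun t => ‖rigidityMap G (γ t) - rigidityMap G p‖ ^ 2 :=
          hE.isTheta_energy.1.comp_tendsto htraj.tendsto
      _ =O[𝓝 0] fun t => (t ^ (k + 1)) ^ 2 := hγ.rigidityMap_sub_isBigO.norm_left.pow 2
      _ =O[𝓝 0] fun t => ‖γ t - p‖ ^ (2 * (k + 1)) := by
        simp only [← pow_mul, mul_comm 2 (k + 1)]
        exact hγ.isTheta_sub.2.norm_right.pow _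
  obtain ⟨c, hc, hbound⟩ := hbound.exists_pos
  obtain ⟨δ, hδ, hball⟩ := Metric.nhds_basis_closedBall.eventually_iff.mp hbound.bound
  refine ⟨γ, htraj, c, δ, hc, hδ, fun t ht => ?_⟩
  have hle := hball (show t ∈ Metric.closedBall 0 δ by simpa [abs_of_nonneg ht.1] using ht.2)
  rw [Real.rpow_natCast]
  simpa only [norm_pow, norm_norm] using (Real.le_norm_self _).trans hle

theorem HasErrorBound.hasRigidityOrder [NeZero n] {m : ℕ} (h : HasErrorBound G p m)
    (hp : IsPinned p) (hm : 2 ≤ m) (hflex : HasFlex G p 1 (m - 1)) :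
    HasRigidityOrder G p m := by
  refine ⟨h.isRigid hp, fun E hE => ?_⟩
  have hslow := hflex.growsSlowly hE
  rw [Nat.sub_add_cancel (by lia)] at hslow
  have horder : 2 * ((m : ℚ) : ℝ) = (2 * m : ℕ) := by push_cast; ring
  rw [horder]
  exact ⟨by positivity, hslow, h.growsQuickly hE⟩

theorem IsPinned.isFlexible_or_hasErrorBound [NeZero n] (hp : IsPinned p)
    (hK : Module.finrank ℝ (firstOrderFlexes G p) = 1) :
    (IsFlexible G p ∧ ∀ k, 1 ≤ k → HasFlex G p 1 k) ∨
      ∃ m, 2 ≤ m ∧ HasFlex G p 1 (m - 1) ∧ HasErrorBound G p m := by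
  let x₀ : pinnedSubmodule n d (spanDim p) := ⟨p, hp.2⟩
  let F : pinnedSubmodule n d (spanDim p) → G.edgeSet → ℝ := fun x => rigidityMap G (x : Config n d)
  have hF : AnalyticAt ℝ F x₀ := (analyticAt_rigidityMap p).fun_comp
    ((pinnedSubmodule n d (spanDim p)).subtypeL.analyticAt x₀)
  rw [firstOrderFlexes_eq_map_ker hp.2, Submodule.finrank_map_subtype_eq] at hK
  obtain ⟨γ, v, hγ, hγ₀, hd, hv, hcase⟩ := exists_curve_eventually_eq_or_isBigO hF hK
  have hγ₀' : (γ 0 : Config n d) = p := congrArg Subtype.val hγ₀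
  have hγ' : AnalyticAt ℝ (fun t => (γ t : Config n d)) 0 :=
    ((pinnedSubmodule n d (spanDim p)).subtypeL.analyticAt _).fun_comp hγ
  have hd' : HasDerivAt (fun t => (γ t : Config n d)) v 0 :=
    (pinnedSubmodule n d (spanDim p)).subtypeL.hasFDerivAt.comp_hasDerivAt 0 hd
  have hflex {k : ℕ} (hk : 1 ≤ k)
      (hO : (fun t => F (γ t) - F x₀) =O[𝓝 0] fun t => t ^ (k + 1)) : HasFlex G p 1 k := by
    refine ⟨_, isFlex_one_of_hasDerivAt hγ hγ₀' hd hv hk ?_⟩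
    rw [forall_isVanishing_iff_isBigO hγ', hγ₀']
    exact hO
  obtain hconst | ⟨m, hm, hO, hbound⟩ := hcase
  · have hO (k : ℕ) : (fun t => F (γ t) - F x₀) =O[𝓝 0] fun t => t ^ (k + 1) :=
      (EventuallyEq.isBigO (hconst.mono fun t ht => sub_eq_zero.mpr ht)).trans (isBigO_zero _ _)
    have hequiv : ∀ᶠ t in 𝓝 0, IsEquivalent G p (γ t) :=
      hconst.mono fun t ht => isEquivalent_iff_rigidityMap_eq.mpr ht.symm
    exact .inl ⟨hp.isFlexible_of_hasDerivAt hγ₀' hd' (by simpa using hv) (fun t => (γ t).2) hequiv,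
      fun k hk => hflex hk (hO k)⟩
  · refine .inr ⟨m, hm, hflex (by lia) ?_, ?_⟩
    · rwa [Nat.sub_add_cancel (by lia)]
    · have hmap : 𝓝[{q | IsPinnedAt (spanDim p) q}] p = map Subtype.val (𝓝 x₀) :=
        nhdsWithin_eq_map_subtype_coe hp.2
      rw [HasErrorBound, hmap, isBigO_map]
      exact hbound

end ErrorBound

end BarFramework

theorem mainTheorem2 {n d : ℕ} (G : SimpleGraph (Fin n)) [DecidableRel G.Adj]
    (p : BarFramework.Config n d)
    (hedge : ∀ i j : Fin n, G.Adj i j → BarFramework.point p i ≠ BarFramework.point p j)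
    (hpin : BarFramework.IsPinned p)
    (hK : Module.finrank ℝ (BarFramework.firstOrderFlexes G p) = 1) :
    (∀ k : ℕ, 2 ≤ k → BarFramework.HasFlex G p 1 (k - 1) → ¬ BarFramework.HasFlex G p 1 k →
      BarFramework.HasRigidityOrder G p (k : ℚ)) ∧
    (∀ k : ℕ, 1 ≤ k → BarFramework.HasFlex G p 1 k →
      BarFramework.IsFlexible G p ∨
        ∃ ν : ℚ, BarFramework.HasRigidityOrder G p ν ∧ (k : ℚ) + 1 ≤ ν) ∧
    ((∃ k : ℕ, 1 ≤ k ∧ ¬ BarFramework.HasFlex G p 1 k) → BarFramework.IsRigid G p) := by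
  have : NeZero n := ⟨by
    rintro rfl
    exact one_ne_zero (hK.symm.trans Module.finrank_zero_of_subsingleton)⟩
  obtain ⟨hflexible, hall⟩ | ⟨m, hm, hflex, hbound⟩ := hpin.isFlexible_or_hasErrorBound hK
  · exact ⟨fun k hk _ hno => absurd (hall k (by lia)) hno, fun k _ _ => .inl hflexible,
      fun ⟨k, hk, hno⟩ => absurd (hall k hk) hno⟩
  · have hrigid := hbound.hasRigidityOrder hpin hm hflex
    refine ⟨fun k hk hyes hno => ?_, fun k _ hyes => .inr ⟨m, hrigid, ?_⟩, fun _ => hrigid.1⟩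
    · have hle : m ≤ k := by
        by_contra! hlt
        exact hno (hflex.of_le (by lia) (by lia))
      have hge : k ≤ m := by simpa [Nat.sub_add_cancel (by lia : 1 ≤ k)] using hbound.succ_le hyes
      rwa [hge.antisymm hle]
    · exact_mod_cast hbound.succ_le hyes
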